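/- **Proposition (anticoncentration via the median regularized LCD).** *Definitions.* For a real random variable $X$ and $\epsilon\ge 0$ let $\mathcal L(X,\epsilon)=\sup_{x\in\mathbb R}\mathbb P[|X-x|\le\epsilon]$. For $c_0,c_1\in(0,1)$, $\operatorname{Incomp}(c_0,c_1)\subseteq\mathbb S^{n-1}$ is the set of unit vectors of $\mathbb R^n$ that are not within Euclidean distance $c_1$ of any vector with at most $c_0n$ nonzero coordinates. For $L\ge 1$ and a unit vector $x\in\mathbb R^N$ let $$D_L(x)=\inf\Big\{\theta>0:\operatorname{dist}(\theta x,\mathbb Z^N)<L\sqrt{\log_+(\theta/L)}\Big\},\qquad \log_+ = \max(\log,0).$$ Given a constant $c_s\in(0,1/5)$, $\lambda\in(0,c_s)$ and $v\in\operatorname{Incomp}(c_0,c_1)$, let $\operatorname{Spread}(v)\subseteq[n]$ be any set of $\lceil c_sn\rceil$ indices $k$ such that $\frac{c_1}{\sqrt{2n}}\le|v_k|\le\frac1{\sqrt{c_0n}}$ (for suitable $c_s$ depending on $c_0,c_1$ and all large $n$ such a set exists for every $v$). Let $\operatorname{Spread}_\lambda(v)$ be any subset of $\operatorname{Spread}(v)$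 whose size is the largest multiple of $\lceil\lambda n\rceil$ not exceeding $\lceil c_sn\rceil$, and let $\operatorname{Spread}_\lambda(v)=\bigsqcup_{j}\operatorname{Spread}^j_\lambda(v)$ be any partition of it into blocks of size $\lceil\lambda n\rceil$. The median regularized LCD $\widehat{MD}_L(v,\lambda)$ is the median of the multiset of the numbers $D_L(v_I/\|v_I\|_2)$, where $I$ runs over the blocks $\operatorname{Spread}^j_\lambda(v)$ and $v_I$ is the restriction of $v$ to the coordinates in $I$; for an even number of blocks the median is the smallest value of the upper half. Let $\mathcal I_M(v)$ be the collection of the blocks $I$ with $D_L(v_I/\|v_I\|_2)\ge\widehat{MD}_L(v,\lambda)$. *Statement.* For all $\epsilon_0,p_0,M_0>0$ there is a constant $C>0$ depending only on $\epsilon_0,p_0,M_0$, and for all $c_0,c_1\in(0,1)$ there are a constant $C'>0$ and an integer $N_0$ depending only on $\epsilon_0,p_0,M_0,c_0,c_1$, such that the following holds for all $n\ge N_0$. Let $\xi_1,\dots,\xi_n$ be i.i.d. random variables with $\mathcal L(\xi_k,\epsilon_0)\le 1-p_0$ and $\mathbb E|\xi_k|\le M_0$ for all $k$. Let $c_s\in(0,1/5)$,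 $L\ge p_0^{-1/2}$, $\lambda\in(C'L^2/n,\,c_s)$ and $v\in\operatorname{Incomp}(c_0,c_1)$, with any choice of the sets $\operatorname{Spread}(v)$, $\operatorname{Spread}_\lambda(v)$, $\operatorname{Spread}^j_\lambda(v)$ as above. Let $J\subseteq\operatorname{Spread}_\lambda(v)$ be a nonempty union of sets in $\mathcal I_M(v)$, and $S_J=\sum_{k\in J}v_k\xi_k$. Then for every $\epsilon\ge 0$, $$\mathcal L(S_J,\epsilon)\le C\,L\left(\frac{\epsilon}{c_1\sqrt{|J|/n}}+\frac{\sqrt{\lambda n/|J|}}{\widehat{MD}_L(v,\lambda)}\right).$$ -/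

import Mathlib

open MeasureTheory ProbabilityTheory

noncomputable section

/-- The Lévy concentration function `ℒ(X, ε) = sup_x ℙ(|X - x| ≤ ε)`. -/
def levyConc {Ω : Type*} [MeasurableSpace Ω] (μ : Measure Ω) (X : Ω → ℝ) (ε : ℝ) : ℝ :=
  ⨆ x : ℝ, μ.real {ω | |X ω - x| ≤ ε}

/-- Compressible unit vectors: those within distance `c₁` of a vector with at most `c₀ n`
nonzero coordinates. -/
def compVectors (n : ℕ) (c₀ c₁ : ℝ) : Set (EuclideanSpace ℝ (Fin n)) :=
  {v | ‖v‖ = 1 ∧ ∃ w : EuclideanSpace ℝ (Fin n),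
    (({k | w k ≠ 0} : Finset (Fin n)).card : ℝ) ≤ c₀ * n ∧ dist v w ≤ c₁}

/-- Incompressible unit vectors. -/
def incompVectors (n : ℕ) (c₀ c₁ : ℝ) : Set (EuclideanSpace ℝ (Fin n)) :=
  {v | ‖v‖ = 1 ∧ v ∉ compVectors n c₀ c₁}

/-- The integer lattice in `ℝ^ι`. -/
def intLattice (ι : Type*) : Set (EuclideanSpace ℝ ι) :=
  {z | ∀ i, ∃ m : ℤ, z i = m}

/-- The (log-normalized) least common denominator `D_L(x)`; `Real.posLog` is `log₊ = max(log, 0)`.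
The set below is nonempty and bounded below whenever `L > 0`. -/
def lcd {ι : Type*} [Fintype ι] (L : ℝ) (x : EuclideanSpace ℝ ι) : ℝ :=
  sInf {θ : ℝ | 0 < θ ∧
    Metric.infDist (θ • x) (intLattice ι) < L * Real.sqrt (Real.posLog (θ / L))}

/-- The restriction `v_I` of `v` to the coordinates in `I`. -/
def restrictCoords {n : ℕ} (v : EuclideanSpace ℝ (Fin n)) (I : Finset (Fin n)) :
    EuclideanSpace ℝ I :=
  WithLp.toLp 2 (fun i : I => v i)

/-- The LCD `D_L(v_I / ‖v_I‖₂)` of the normalized restriction of `v` to `I`. -/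
def blockLcd {n : ℕ} (L : ℝ) (v : EuclideanSpace ℝ (Fin n)) (I : Finset (Fin n)) : ℝ :=
  lcd L (‖restrictCoords v I‖⁻¹ • restrictCoords v I)

/-- The median of a nonempty multiset of reals; for an even number of elements it is the smallest
element of the upper half, not an average. -/
def upperMedian (s : Multiset ℝ) : ℝ :=
  (s.sort (· ≤ ·)).getD (s.card / 2) 0

/-- A choice of the sets `Spread(v)`, `Spread_λ(v)` and `Spread_λ^j(v)`, `j = 1, …, k`, attached to
the vector `v`, where `cs` is the spread constant: `|Spread(v)| = ⌈cs n⌉`, the size of `Spread_λ(v)`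
is the largest multiple of `⌈λ n⌉` that is at most `⌈cs n⌉`, and the blocks `Spread_λ^j(v)`
partition `Spread_λ(v)` into sets of size `⌈λ n⌉`. -/
structure SpreadData (n : ℕ) (c₀ c₁ cs lam : ℝ) (v : EuclideanSpace ℝ (Fin n)) where
  spread : Finset (Fin n)
  card_spread : spread.card = ⌈cs * n⌉₊
  lower_bound : ∀ k ∈ spread, c₁ / Real.sqrt (2 * n) ≤ |v k|
  upper_bound : ∀ k ∈ spread, |v k| ≤ 1 / Real.sqrt (c₀ * n)
  spreadLam : Finset (Fin n)
  spreadLam_subset : spreadLam ⊆ spread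
  card_spreadLam : spreadLam.card = (⌈cs * n⌉₊ / ⌈lam * n⌉₊) * ⌈lam * n⌉₊
  block : Fin (⌈cs * n⌉₊ / ⌈lam * n⌉₊) → Finset (Fin n)
  card_block : ∀ j, (block j).card = ⌈lam * n⌉₊
  disjoint_block : ∀ i j, i ≠ j → Disjoint (block i) (block j)
  union_block : Finset.univ.biUnion block = spreadLam

namespace SpreadData

variable {n : ℕ} {c₀ c₁ cs lam : ℝ} {v : EuclideanSpace ℝ (Fin n)}

/-- The median regularized LCD: the median of the LCDs of the normalized blocks of `v`. -/
def mrlcd (S : SpreadData n c₀ c₁ cs lam v) (L : ℝ) : ℝ :=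
  upperMedian ((Finset.univ : Finset (Fin (⌈cs * n⌉₊ / ⌈lam * n⌉₊))).val.map
    (fun j => blockLcd L v (S.block j)))

/-- The collection of blocks whose LCD is at least the median. -/
def medianBlocks (S : SpreadData n c₀ c₁ cs lam v) (L : ℝ) : Set (Finset (Fin n)) :=
  {I | (∃ j, I = S.block j) ∧ S.mrlcd L ≤ blockLcd L v I}

end SpreadData

end

/-! By Esseen's inequality, the small ball probability is controlled by the integral of the
characteristic function of `S_J` over `[0, 1/ε]`. Symmetrising, with `Y` distributed as the
difference of two independent copies of `ξ`, bounds its modulus by `exp (-F/2)`, where `F t` is the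
sum over `k ∈ J` of `𝔼 (1 - cos (t v_k Y))` (`cosDefect`). This `F` is the sum of the defects `F_I`
of the `m` blocks forming `J`. Convexity of `exp` replaces the product over blocks by an average of
the functions `exp (-(m/2) F_I)`, so each block can be treated alone, with a large exponent.

For one block (`integral_exp_neg_cosDefect_le`), condition `Y` on `ε₀ < |Y| ≤ K`, an event of
probability at least `3p₀/4`, and fix its value. The defect then dominates the squared distance from
a multiple `θ` of the normalized block to the integer lattice. For `θ` of order `L` or less this
distance is `|θ|` itself, since the coordinates are small; beyond that, and below the LCD, it is at
least `L √(log (θ/L))`. With `κ` in the exponent this gives a Gaussian plus a power tail in `θ/L`,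
of integral `O(1/√κ)`.

This covers a window around the origin whose length `τ` is proportional to the LCD. Since `F_I (t -
s) ≤ 2 F_I t + 2 F_I s`, any other window of length `τ` is reduced to that one. Summing windows
gives `ε + 1/τ`, and `κ` of order `m` gives the gain `1/√m`, which turns the block scale into the
scale of `J` (`measureReal_abs_sum_sub_le`). -/

/-! ### Esseen's inequality via the Fejér kernel. -/

theorem integral_one_sub_mul_cos {x : ℝ} (hx : x ≠ 0) :
    ∫ t in (0 : ℝ)..1, (1 - t) * Real.cos (t * x) = (1 - Real.cos x) / x ^ 2 := by
  have hd : ∀ t ∈ Set.uIcc (0 : ℝ) 1, HasDerivAt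
      (fun t => (1 - t) * Real.sin (t * x) / x - Real.cos (t * x) / x ^ 2)
      ((1 - t) * Real.cos (t * x)) t := by
    intro t _
    have h0 : HasDerivAt (fun t : ℝ => t * x) x t := by
      simpa using (hasDerivAt_id t).mul_const x
    have h1 : HasDerivAt (fun t : ℝ => 1 - t) (-1) t := by
      simpa using (hasDerivAt_id t).const_sub 1
    convert! ((h1.mul h0.sin).div_const x).sub (h0.cos.div_const (x ^ 2)) using 1
    field_simp
    ring
  rw [intervalIntegral.integral_eq_sub_of_hasDerivAt hd
    (by apply Continuous.intervalIntegrable; fun_prop)]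
  simp
  ring

/-- The triangle weight `1 - t` makes the kernel nonnegative, so Markov's inequality applies to it.
-/
theorem integral_one_sub_mul_cos_nonneg (x : ℝ) :
    0 ≤ ∫ t in (0 : ℝ)..1, (1 - t) * Real.cos (t * x) := by
  rcases eq_or_ne x 0 with rfl | hx
  · apply intervalIntegral.integral_nonneg zero_le_one
    intro t ht
    simp only [mul_zero, Real.cos_zero, mul_one]
    linarith [ht.2]
  · rw [integral_one_sub_mul_cos hx]
    have := Real.cos_le_one x
    exact div_nonneg (by linarith) (sq_nonneg x)

theorem one_fifth_le_integral_one_sub_mul_cos {x : ℝ} (hx : |x| ≤ 1) :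
    1 / 5 ≤ ∫ t in (0 : ℝ)..1, (1 - t) * Real.cos (t * x) := by
  rcases eq_or_ne x 0 with rfl | hx0
  · have : ∫ t in (0 : ℝ)..1, (1 - t) * Real.cos (t * 0) = 1 / 2 := by
      simp only [mul_zero, Real.cos_zero, mul_one]
      rw [intervalIntegral.integral_sub (by simp) (by simp), integral_id]
      norm_num
    rw [this]
    norm_num
  · rw [integral_one_sub_mul_cos hx0]
    have hπ := Real.pi_gt_three
    have hπ' := Real.pi_lt_d2
    have h := Real.cos_le_one_sub_mul_cos_sq (x := x) (by linarith)
    have hx2 : 0 < x ^ 2 := by positivity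
    rw [le_div_iff₀ hx2]
    have h2 : 1 / 5 ≤ 2 / Real.pi ^ 2 := by
      rw [div_le_div_iff₀ (by norm_num) (by positivity)]
      nlinarith
    nlinarith

theorem integral_cos_sub_le_norm_charFun (ρ : Measure ℝ) [IsProbabilityMeasure ρ] (s x : ℝ) :
    ∫ y, Real.cos (s * (y - x)) ∂ρ ≤ ‖charFun ρ s‖ := by
  have hint : Integrable (fun y : ℝ => Complex.exp ((s * (y - x) : ℝ) * Complex.I)) ρ := by
    apply Integrable.of_bound (C := 1) (by fun_prop)
    filter_upwards with y
    rw [Complex.norm_exp_ofReal_mul_I]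
  have h1 : ∫ y, Real.cos (s * (y - x)) ∂ρ
      = (∫ y, Complex.exp ((s * (y - x) : ℝ) * Complex.I) ∂ρ).re := by
    rw [← RCLike.re_eq_complex_re, ← integral_re hint]
    simp only [RCLike.re_eq_complex_re, Complex.exp_ofReal_mul_I_re]
  have h2 : ∫ y, Complex.exp ((s * (y - x) : ℝ) * Complex.I) ∂ρ
      = Complex.exp ((-(s * x) : ℝ) * Complex.I) * charFun ρ s := by
    rw [charFun_apply_real, ← integral_const_mul]
    congr 1
    ext y
    rw [← Complex.exp_add]
    congr 1
    push_cast
    ring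
  rw [h1, h2]
  refine (Complex.re_le_norm _).trans ?_
  rw [norm_mul, Complex.norm_exp_ofReal_mul_I, one_mul]

/-- Esseen's inequality. -/
theorem measureReal_abs_sub_le_le_integral_charFun (ρ : Measure ℝ) [IsProbabilityMeasure ρ]
    (x : ℝ) {ε : ℝ} (hε : 0 < ε) :
    ρ.real {y | |y - x| ≤ ε} ≤ 5 * (ε * ∫ t in (0 : ℝ)..1 / ε, ‖charFun ρ t‖) := by
  set k : ℝ → ℝ := fun y => ∫ t in (0 : ℝ)..1, (1 - t) * Real.cos (t * ((y - x) / ε)) with hk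
  have hprod : Integrable (Function.uncurry fun t y : ℝ =>
      (1 - t) * Real.cos (t * ((y - x) / ε)))
      ((volume.restrict (Set.uIoc (0 : ℝ) 1)).prod ρ) := by
    have : IsFiniteMeasure (volume.restrict (Set.uIoc (0 : ℝ) 1)) := by
      rw [Set.uIoc_of_le zero_le_one]
      infer_instance
    apply Integrable.mono' (g := fun _ => (1 : ℝ)) (integrable_const _)
    · apply Continuous.aestronglyMeasurable
      fun_prop
    · have : ∀ᵐ p ∂((volume.restrict (Set.uIoc (0 : ℝ) 1)).prod ρ), p.1 ∈ Set.uIoc (0 : ℝ) 1 := by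
        exact Measure.quasiMeasurePreserving_fst.ae (ae_restrict_mem measurableSet_uIoc)
      filter_upwards [this] with p hp
      rw [Set.uIoc_of_le zero_le_one] at hp
      simp only [Function.uncurry, Real.norm_eq_abs, abs_mul]
      have h1 : |1 - p.1| ≤ 1 := by rw [abs_le]; constructor <;> linarith [hp.1, hp.2]
      have h2 := Real.abs_cos_le_one (p.1 * ((p.2 - x) / ε))
      exact mul_le_one₀ h1 (abs_nonneg _) h2
  have hki : Integrable k ρ := by
    have := hprod.integral_prod_right
    simpa [hk, intervalIntegral.integral_of_le, Set.uIoc_of_le, Function.uncurry] using this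
  have hstep : ∫ y, k y ∂ρ ≤ ∫ t in (0 : ℝ)..1, ‖charFun ρ (t / ε)‖ := by
    have hswap : ∫ y, k y ∂ρ
        = ∫ t in (0 : ℝ)..1, ∫ y, (1 - t) * Real.cos (t * ((y - x) / ε)) ∂ρ := by
      rw [intervalIntegral_integral_swap hprod]
    rw [hswap]
    apply intervalIntegral.integral_mono_on zero_le_one
    · rw [intervalIntegrable_iff]
      exact hprod.integral_prod_left
    · apply Continuous.intervalIntegrable
      exact (continuous_charFun.comp (by fun_prop)).norm
    -- The weight `1 - t ≤ 1` is dropped here.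
    · intro t ht
      rw [integral_const_mul]
      have h1 := integral_cos_sub_le_norm_charFun ρ (t / ε) x
      have h2 : ∀ y, t * ((y - x) / ε) = t / ε * (y - x) := fun y => by ring
      simp only [h2]
      have h3 := norm_nonneg (charFun ρ (t / ε))
      nlinarith [ht.1, ht.2]
  have hmarkov : 1 / 5 * ρ.real {y | 1 / 5 ≤ k y} ≤ ∫ y, k y ∂ρ :=
    mul_meas_ge_le_integral_of_nonneg
      (Filter.Eventually.of_forall fun y => integral_one_sub_mul_cos_nonneg _) hki _
  have hsub : ρ.real {y | |y - x| ≤ ε} ≤ ρ.real {y | 1 / 5 ≤ k y} := by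
    apply measureReal_mono _ (measure_ne_top _ _)
    intro y hy
    apply one_fifth_le_integral_one_sub_mul_cos
    rw [abs_div, abs_of_pos hε, div_le_one hε]
    exact hy
  rw [intervalIntegral.integral_comp_div (fun t => ‖charFun ρ t‖) hε.ne', zero_div,
    smul_eq_mul] at hstep
  linarith

/-! ### Moving windows to the origin. -/

/-- Concentration of a nonnegative function that is approximately subadditive: the integral of
`exp (-κ F)` over an interval is controlled by an integral around the origin. -/
theorem integral_exp_neg_shift_le {F : ℝ → ℝ} (hF : Continuous F)
    (hsub : ∀ s t, F (t - s) ≤ 2 * F t + 2 * F s) {κ : ℝ} (hκ : 0 ≤ κ) (T : ℝ) {τ : ℝ}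
    (hτ : 0 ≤ τ) :
    ∫ t in T..T + τ, Real.exp (-(κ * F t)) ≤ ∫ t in -τ..τ, Real.exp (-(κ / 4 * F t)) := by
  -- Recentring at a minimiser gives `F (t - t₀) ≤ 2 F t + 2 F t₀ ≤ 4 F t`, whence `κ / 4`.
  obtain ⟨t₀, ht₀, hmin⟩ := (isCompact_Icc (a := T) (b := T + τ)).exists_isMinOn
    ⟨T, by simp [hτ]⟩ hF.continuousOn
  have hcont : Continuous fun t => Real.exp (-(κ / 4 * F t)) := by fun_prop
  calc ∫ t in T..T + τ, Real.exp (-(κ * F t))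
      ≤ ∫ t in T..T + τ, Real.exp (-(κ / 4 * F (t - t₀))) := by
        apply intervalIntegral.integral_mono_on (by linarith)
        · apply Continuous.intervalIntegrable; fun_prop
        · apply Continuous.intervalIntegrable; fun_prop
        · intro t ht
          have h1 := hsub t₀ t
          have h2 : F t₀ ≤ F t := hmin ht
          rw [Real.exp_le_exp]
          nlinarith
    _ = ∫ t in T - t₀..T + τ - t₀, Real.exp (-(κ / 4 * F t)) :=
        intervalIntegral.integral_comp_sub_right (fun t => Real.exp (-(κ / 4 * F t))) t₀
    _ ≤ ∫ t in -τ..τ, Real.exp (-(κ / 4 * F t)) := by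
        apply intervalIntegral.integral_mono_interval
        · linarith [ht₀.2]
        · linarith
        · linarith [ht₀.1]
        · exact Filter.Eventually.of_forall fun t => (Real.exp_pos _).le
        · exact hcont.intervalIntegrable _ _

theorem integral_le_of_forall_integral_le {g : ℝ → ℝ} (hg : Continuous g) (hg0 : ∀ t, 0 ≤ g t)
    {τ A R : ℝ} (hτ : 0 < τ) (hR : 0 ≤ R) (hA : ∀ T, ∫ t in T..T + τ, g t ≤ A) :
    ∫ t in (0 : ℝ)..R, g t ≤ (R / τ + 1) * A := by
  set N := ⌈R / τ⌉₊ with hN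
  have hA0 : 0 ≤ A := le_trans (intervalIntegral.integral_nonneg (by linarith) fun t _ => hg0 t)
    (hA 0)
  have hRN : R ≤ N * τ := by
    rw [← div_le_iff₀ hτ]
    exact Nat.le_ceil _
  have hsum := intervalIntegral.sum_integral_adjacent_intervals (f := g) (μ := volume)
    (a := fun i : ℕ => (i : ℝ) * τ) (n := N) fun k _ => hg.intervalIntegrable _ _
  calc ∫ t in (0 : ℝ)..R, g t ≤ ∫ t in (0 : ℝ)..N * τ, g t := by
        apply intervalIntegral.integral_mono_interval le_rfl hR hRN
        · exact Filter.Eventually.of_forall hg0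
        · exact hg.intervalIntegrable _ _
    _ = ∑ i ∈ Finset.range N, ∫ t in (i : ℝ) * τ..((i + 1 : ℕ) : ℝ) * τ, g t := by
        simpa using hsum.symm
    _ ≤ ∑ _i ∈ Finset.range N, A := by
        apply Finset.sum_le_sum
        intro i _
        have : ((i + 1 : ℕ) : ℝ) * τ = i * τ + τ := by push_cast; ring
        rw [this]
        exact hA _
    _ = N * A := by simp
    _ ≤ (R / τ + 1) * A := by
        gcongr
        exact (Nat.ceil_lt_add_one (by positivity)).le

/-! ### Symmetrisation and the cosine defect. -/

/-- The law of `X - X'` where `X`, `X'` are independent with law `ρ`. -/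
noncomputable def symmLaw (ρ : Measure ℝ) : Measure ℝ := (ρ.prod ρ).map fun p => p.1 - p.2

instance (ρ : Measure ℝ) [IsProbabilityMeasure ρ] : IsProbabilityMeasure (symmLaw ρ) :=
  Measure.isProbabilityMeasure_map (by fun_prop)

theorem integral_cos_symmLaw (ρ : Measure ℝ) [IsProbabilityMeasure ρ] (s : ℝ) :
    ∫ y, Real.cos (s * y) ∂(symmLaw ρ) = ‖charFun ρ s‖ ^ 2 := by
  have hint : Integrable (fun p : ℝ × ℝ => Complex.exp (s * p.1 * Complex.I) *
      Complex.exp ((-s : ℝ) * p.2 * Complex.I)) (ρ.prod ρ) := by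
    apply Integrable.of_bound (C := 1) (by fun_prop)
    filter_upwards with p
    rw [norm_mul, ← Complex.ofReal_mul, ← Complex.ofReal_mul, Complex.norm_exp_ofReal_mul_I,
      Complex.norm_exp_ofReal_mul_I, one_mul]
  have h1 : ∫ p : ℝ × ℝ, Complex.exp (s * p.1 * Complex.I) *
      Complex.exp ((-s : ℝ) * p.2 * Complex.I) ∂(ρ.prod ρ) = charFun ρ s * charFun ρ (-s) := by
    rw [charFun_apply_real, charFun_apply_real,
      integral_prod_mul (fun x : ℝ => Complex.exp (s * x * Complex.I))
        (fun x : ℝ => Complex.exp ((-s : ℝ) * x * Complex.I))]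
  have h2 : ∀ p : ℝ × ℝ, Real.cos (s * (p.1 - p.2)) = RCLike.re (Complex.exp (s * p.1 * Complex.I) *
      Complex.exp ((-s : ℝ) * p.2 * Complex.I)) := by
    intro p
    rw [← Complex.exp_add, RCLike.re_eq_complex_re, ← Complex.exp_ofReal_mul_I_re]
    congr 2
    push_cast
    ring
  rw [symmLaw, integral_map (by fun_prop) (by fun_prop)]
  simp only [h2]
  rw [integral_re hint, h1, charFun_neg, Complex.mul_conj, RCLike.re_eq_complex_re,
    Complex.ofReal_re, Complex.normSq_eq_norm_sq]

/-- The exponent `∑ k ∈ I, 𝔼 (1 - cos (t a_k Y))`, where `Y` has law `ν`. -/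
noncomputable def cosDefect {ι : Type*} (ν : Measure ℝ) (I : Finset ι) (a : ι → ℝ) (t : ℝ) : ℝ :=
  ∫ y, ∑ k ∈ I, (1 - Real.cos (t * a k * y)) ∂ν

section

variable {ι : Type*} (ν : Measure ℝ) [IsProbabilityMeasure ν] (I : Finset ι) (a : ι → ℝ)

theorem abs_sum_one_sub_cos_le (c : ι → ℝ) :
    |∑ k ∈ I, (1 - Real.cos (c k))| ≤ I.card * 2 := by
  refine (Finset.abs_sum_le_sum_abs _ _).trans ?_
  calc _ ≤ ∑ k ∈ I, (2 : ℝ) := by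
        apply Finset.sum_le_sum
        intro k _
        rw [abs_le]
        constructor <;> linarith [Real.cos_le_one (c k), Real.neg_one_le_cos (c k)]
    _ = I.card * 2 := by simp

theorem integrable_sum_one_sub_cos (t : ℝ) :
    Integrable (fun y => ∑ k ∈ I, (1 - Real.cos (t * a k * y))) ν := by
  apply Integrable.of_bound (C := I.card * 2) (by fun_prop)
  filter_upwards with y
  exact abs_sum_one_sub_cos_le I _

theorem continuous_cosDefect : Continuous (cosDefect ν I a) := by
  apply continuous_of_dominated (bound := fun _ => I.card * 2)
  · intro t
    exact (integrable_sum_one_sub_cos ν I a t).aestronglyMeasurable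
  · intro t
    filter_upwards with y
    exact abs_sum_one_sub_cos_le I _
  · exact integrable_const _
  · filter_upwards with y
    fun_prop

/-- Since `1 - cos x = |e^{ix} - 1|² / 2`, this is the inequality `|a - b|² ≤ 2|a|² + 2|b|²`. -/
theorem one_sub_cos_sub_le (x y : ℝ) :
    1 - Real.cos (x - y) ≤ 2 * (1 - Real.cos x) + 2 * (1 - Real.cos y) := by
  rw [Real.cos_sub]
  nlinarith [sq_nonneg (Real.sin x + Real.sin y), sq_nonneg (Real.cos x + Real.cos y - 2),
    Real.sin_sq_add_cos_sq x, Real.sin_sq_add_cos_sq y]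

theorem cosDefect_sub_le (s t : ℝ) :
    cosDefect ν I a (t - s) ≤ 2 * cosDefect ν I a t + 2 * cosDefect ν I a s := by
  unfold cosDefect
  have h := integrable_sum_one_sub_cos ν I a
  rw [← integral_const_mul, ← integral_const_mul,
    ← integral_add ((h t).const_mul 2) ((h s).const_mul 2)]
  apply integral_mono (h _) (((h t).const_mul 2).add ((h s).const_mul 2))
  intro y
  simp only [Finset.mul_sum, ← Finset.sum_add_distrib, Pi.add_apply]
  apply Finset.sum_le_sum
  intro k _
  have := one_sub_cos_sub_le (t * a k * y) (s * a k * y)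
  rwa [← sub_mul, ← sub_mul] at this

theorem cosDefect_eq_sum (t : ℝ) :
    cosDefect ν I a t = ∑ k ∈ I, (1 - ∫ y, Real.cos (t * a k * y) ∂ν) := by
  have hc : ∀ k, Integrable (fun y => Real.cos (t * a k * y)) ν := fun k => by
    apply Integrable.of_bound (C := 1) (by fun_prop)
    filter_upwards with y
    exact Real.abs_cos_le_one _
  unfold cosDefect
  rw [integral_finsetSum I (f := fun k y => 1 - Real.cos (t * a k * y))
    fun k _ => (integrable_const _).sub (hc k)]
  refine Finset.sum_congr rfl fun k _ => ?_
  rw [integral_sub (integrable_const _) (hc k)]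
  simp

theorem cosDefect_biUnion {κ : Type*} [DecidableEq ι] (T : Finset κ) (B : κ → Finset ι)
    (hB : (T : Set κ).PairwiseDisjoint B) (t : ℝ) :
    cosDefect ν (T.biUnion B) a t = ∑ j ∈ T, cosDefect ν (B j) a t := by
  simp only [cosDefect_eq_sum]
  exact Finset.sum_biUnion hB

end

/-- The integral is `r²` with `r` the modulus; take square roots in `r² ≤ exp (r² - 1)`. -/
theorem norm_charFun_le_exp (ρ : Measure ℝ) [IsProbabilityMeasure ρ] (s : ℝ) :
    ‖charFun ρ s‖ ≤ Real.exp (-(1 / 2 * (1 - ∫ y, Real.cos (s * y) ∂(symmLaw ρ)))) := by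
  rw [integral_cos_symmLaw]
  set r := ‖charFun ρ s‖ with hr
  have hr0 : 0 ≤ r := norm_nonneg _
  have h1 : r ^ 2 ≤ Real.exp (-(1 / 2 * (1 - r ^ 2))) ^ 2 := by
    rw [← Real.exp_nat_mul]
    have := Real.add_one_le_exp (r ^ 2 - 1)
    convert this using 1 <;> [ring; (congr 1; push_cast; ring)]
  exact (sq_le_sq₀ hr0 (Real.exp_pos _).le).mp h1

theorem norm_charFun_map_sum_le {Ω ι : Type*} [MeasurableSpace Ω] {μ : Measure Ω}
    [IsProbabilityMeasure μ] {ξ : ι → Ω → ℝ} (hm : ∀ k, Measurable (ξ k)) (hi : iIndepFun ξ μ)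
    {ρ : Measure ℝ} [IsProbabilityMeasure ρ] (hρ : ∀ k, μ.map (ξ k) = ρ) (J : Finset ι)
    (a : ι → ℝ) (t : ℝ) :
    ‖charFun (μ.map fun ω => ∑ k ∈ J, a k * ξ k ω) t‖
      ≤ Real.exp (-(1 / 2 * cosDefect (symmLaw ρ) J a t)) := by
  have hind : iIndepFun (fun k ω => a k * ξ k ω) μ :=
    hi.comp (fun k x => a k * x) fun k => by fun_prop
  rw [iIndepFun.charFun_map_fun_finsetSum_eq_prod (fun k _ => by have := hm k; fun_prop)
      (hind.restrict _),
    Finset.prod_apply, norm_prod, cosDefect_eq_sum, Finset.mul_sum, ← Finset.sum_neg_distrib,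
    Real.exp_sum]
  apply Finset.prod_le_prod
  · intro k _
    exact norm_nonneg _
  · intro k _
    rw [charFun_map_mul_comp (hm k).aemeasurable, hρ, mul_comm (a k) t]
    exact norm_charFun_le_exp ρ (t * a k)

/-! ### The LCD, lattice distance and cosine sums. -/

section

variable {ι : Type*} [Fintype ι]

theorem infDist_intLattice_sq_le (x : EuclideanSpace ℝ ι) :
    Metric.infDist x (intLattice ι) ^ 2 ≤ ∑ i, (x i - round (x i)) ^ 2 := by
  set z : EuclideanSpace ℝ ι := WithLp.toLp 2 fun i => (round (x i) : ℝ) with hz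
  have hzm : z ∈ intLattice ι := fun i => ⟨round (x i), rfl⟩
  have h1 := Metric.infDist_le_dist_of_mem (x := x) hzm
  calc Metric.infDist x (intLattice ι) ^ 2 ≤ dist x z ^ 2 := by
        gcongr
        exact Metric.infDist_nonneg
    _ = ∑ i, (x i - round (x i)) ^ 2 := by
        rw [EuclideanSpace.dist_eq, Real.sq_sqrt (by positivity)]
        simp [hz, Real.dist_eq, sq_abs]

/-- The distance to the lattice is bounded while the logarithm is not. Without this, `sInf` could
take its default value `0`. -/
theorem lcd_set_nonempty {L : ℝ} (hL : 0 < L) (x : EuclideanSpace ℝ ι) :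
    {θ : ℝ | 0 < θ ∧ Metric.infDist (θ • x) (intLattice ι)
      < L * Real.sqrt (Real.posLog (θ / L))}.Nonempty := by
  set R : ℝ := Fintype.card ι / L ^ 2 + 1 with hR
  have hR0 : 0 < R := by positivity
  refine ⟨L * Real.exp R, by positivity, ?_⟩
  have h1 : Real.posLog (L * Real.exp R / L) = R := by
    rw [mul_div_cancel_left₀ _ hL.ne', Real.posLog_eq_log, Real.log_exp]
    rw [abs_of_pos (Real.exp_pos _)]
    exact Real.one_le_exp hR0.le
  rw [h1]
  apply lt_of_pow_lt_pow_left₀ 2 (by positivity)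
  refine (infDist_intLattice_sq_le _).trans_lt ?_
  rw [mul_pow, Real.sq_sqrt hR0.le, hR]
  calc _ ≤ ∑ _i : ι, (1 : ℝ) := by
        apply Finset.sum_le_sum
        intro i _
        have := abs_sub_round ((L * Real.exp R) • x i)
        rw [sq_le_one_iff_abs_le_one]
        exact this.trans (by norm_num)
    _ < L ^ 2 * (Fintype.card ι / L ^ 2 + 1) := by
        have : 0 < L ^ 2 := by positivity
        simp
        field_simp
        linarith

/-- For `θ ≤ L` the threshold vanishes, and no distance is below `0`. -/
theorem le_lcd {L : ℝ} (hL : 0 < L) (x : EuclideanSpace ℝ ι) : L ≤ lcd L x := by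
  apply le_csInf (lcd_set_nonempty hL x)
  rintro θ ⟨hθ, h⟩
  by_contra! hlt
  have : Real.posLog (θ / L) = 0 := by
    rw [Real.posLog_eq_zero_iff, abs_of_pos (by positivity), div_le_one hL]
    exact hlt.le
  rw [this] at h
  simp at h
  exact absurd h (not_lt.mpr Metric.infDist_nonneg)

theorem le_infDist_of_lt_lcd {L θ : ℝ} {x : EuclideanSpace ℝ ι} (hθ : 0 < θ) (h : θ < lcd L x) :
    L * Real.sqrt (Real.posLog (θ / L)) ≤ Metric.infDist (θ • x) (intLattice ι) := by
  by_contra! hlt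
  have hle : lcd L x ≤ θ := csInf_le ⟨0, fun _ hy => hy.1.le⟩ ⟨hθ, hlt⟩
  exact absurd hle (not_le.mpr h)

theorem eight_mul_sq_le_one_sub_cos {u : ℝ} (hu : |u| ≤ 1 / 2) :
    8 * u ^ 2 ≤ 1 - Real.cos (2 * Real.pi * u) := by
  have hπ := Real.pi_pos
  have h := Real.cos_le_one_sub_mul_cos_sq (x := 2 * Real.pi * u) (by
    rw [abs_mul, abs_of_pos (by positivity)]
    nlinarith)
  have : 2 / Real.pi ^ 2 * (2 * Real.pi * u) ^ 2 = 8 * u ^ 2 := by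
    field_simp
    ring
  linarith

theorem eight_mul_sub_round_sq_le_one_sub_cos (u : ℝ) :
    8 * (u - round u) ^ 2 ≤ 1 - Real.cos (2 * Real.pi * u) := by
  have h := eight_mul_sq_le_one_sub_cos (abs_sub_round u)
  have : 2 * Real.pi * (u - round u) = 2 * Real.pi * u - round u * (2 * Real.pi) := by ring
  rwa [this, Real.cos_sub_int_mul_two_pi] at h

theorem posLog_le_sum_one_sub_cos {L θ : ℝ} (hL : 0 < L) {x : EuclideanSpace ℝ ι} (hθ : 0 < θ)
    (h : θ < lcd L x) :
    8 * L ^ 2 * Real.posLog (θ / L) ≤ ∑ i, (1 - Real.cos (2 * Real.pi * (θ * x i))) := by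
  have h1 := le_infDist_of_lt_lcd hθ h
  have h2 := infDist_intLattice_sq_le (θ • x)
  have h3 : L ^ 2 * Real.posLog (θ / L) ≤ Metric.infDist (θ • x) (intLattice ι) ^ 2 := by
    calc _ = (L * Real.sqrt (Real.posLog (θ / L))) ^ 2 := by
          rw [mul_pow, Real.sq_sqrt Real.posLog_nonneg]
      _ ≤ _ := by gcongr
  have h4 : 8 * ∑ i, ((θ • x) i - round ((θ • x) i)) ^ 2
      ≤ ∑ i, (1 - Real.cos (2 * Real.pi * (θ * x i))) := by
    rw [Finset.mul_sum]
    exact Finset.sum_le_sum fun i _ => eight_mul_sub_round_sq_le_one_sub_cos _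
  linarith

/-- This serves the small frequencies, where `posLog` gives little or nothing: no coordinate has yet
left `[-1/2, 1/2]`, so no rounding occurs. -/
theorem eight_mul_sq_le_sum_one_sub_cos {θ : ℝ} {x : EuclideanSpace ℝ ι} (hx : ‖x‖ = 1)
    (h : ∀ i, |θ * x i| ≤ 1 / 2) :
    8 * θ ^ 2 ≤ ∑ i, (1 - Real.cos (2 * Real.pi * (θ * x i))) := by
  have h1 : ∑ i, x i ^ 2 = 1 := by
    have := EuclideanSpace.norm_sq_eq x
    rw [hx] at this
    simpa using this.symm
  calc 8 * θ ^ 2 = ∑ i, 8 * (θ * x i) ^ 2 := by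
        rw [← Finset.mul_sum]
        simp only [mul_pow]
        rw [← Finset.mul_sum, h1, mul_one]
    _ ≤ _ := Finset.sum_le_sum fun i _ => eight_mul_sq_le_one_sub_cos (h i)

end

/-! ### The integral around the origin for one block. -/

/-- Pointwise bound in the variable `u = θ / L`, on the range below the LCD. -/
theorem exp_neg_le_of_lt_lcd {ι : Type*} [Fintype ι] {L β κ θ : ℝ} (hL : 0 < L) (hκ : 0 ≤ κ)
    (hβ : 6 * κ ≤ 8 * β * L ^ 2) {x : EuclideanSpace ℝ ι} (hx : ‖x‖ = 1)
    (hx2 : ∀ i, 2 * L * |x i| ≤ 1 / 2) (hθ : |θ| < lcd L x) :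
    Real.exp (-(β * ∑ i, (1 - Real.cos (2 * Real.pi * (θ * x i)))))
      ≤ Real.exp (-(6 * κ) * (θ / L) ^ 2)
        + (Set.Ioi (2 : ℝ)).indicator (fun u => u ^ (-(6 * κ))) |θ / L| := by
  have hβ0 : 0 ≤ β := by
    by_contra! h
    have : 0 < L ^ 2 := by positivity
    nlinarith
  have heven : ∑ i, (1 - Real.cos (2 * Real.pi * (θ * x i)))
      = ∑ i, (1 - Real.cos (2 * Real.pi * (|θ| * x i))) := by
    rcases abs_choice θ with h | h <;> rw [h]
    simp [Real.cos_neg]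
  rcases le_or_gt |θ / L| 2 with hu | hu
  · rw [Set.indicator_of_notMem (by simpa using hu), add_zero, Real.exp_le_exp]
    have hθL : |θ| ≤ 2 * L := by
      rwa [abs_div, abs_of_pos hL, div_le_iff₀ hL] at hu
    have h := eight_mul_sq_le_sum_one_sub_cos (θ := θ) hx fun i => by
      rw [abs_mul]
      exact (mul_le_mul_of_nonneg_right hθL (abs_nonneg _)).trans (hx2 i)
    have h1 : θ ^ 2 = L ^ 2 * (θ / L) ^ 2 := by field_simp
    rw [h1] at h
    have h2 := mul_le_mul_of_nonneg_left h hβ0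
    have h3 := mul_le_mul_of_nonneg_right hβ (sq_nonneg (θ / L))
    linarith
  · rw [Set.indicator_of_mem (by simpa using hu)]
    have hθ0 : 0 < |θ| / L := by
      rw [abs_div, abs_of_pos hL] at hu
      linarith
    have h := posLog_le_sum_one_sub_cos hL (x := x) (by
      rwa [div_pos_iff_of_pos_right hL] at hθ0) hθ
    rw [← heven] at h
    rw [abs_div, abs_of_pos hL] at hu ⊢
    rw [Real.posLog_eq_log (by rw [abs_of_pos hθ0]; linarith)] at h
    have hlog : 0 ≤ Real.log (|θ| / L) := Real.log_nonneg (by linarith)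
    refine le_add_of_nonneg_of_le (Real.exp_pos _).le ?_
    rw [Real.rpow_def_of_pos hθ0, Real.exp_le_exp]
    have h2 := mul_le_mul_of_nonneg_left h hβ0
    have h3 := mul_le_mul_of_nonneg_right hβ hlog
    linarith

/-- The condition `κ ≥ 1/4` puts the tail exponent `6κ` at `3/2` or more, so the tail is integrable
and its integral is `O(1/κ)`, hence `O(1/√κ)`. -/
theorem integral_gaussian_add_tail {κ : ℝ} (hκ : 1 / 4 ≤ κ) :
    Integrable (fun u : ℝ => Real.exp (-(6 * κ) * u ^ 2)
        + (Set.Ioi (2 : ℝ)).indicator (fun u => u ^ (-(6 * κ))) |u|) ∧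
      ∫ u : ℝ, (Real.exp (-(6 * κ) * u ^ 2)
        + (Set.Ioi (2 : ℝ)).indicator (fun u => u ^ (-(6 * κ))) |u|) ≤ 3 / Real.sqrt κ := by
  have hκ0 : 0 < κ := by linarith
  have hg : Integrable fun u : ℝ => Real.exp (-(6 * κ) * u ^ 2) :=
    integrable_exp_neg_mul_sq (by linarith)
  have ht : IntegrableOn (fun u : ℝ => u ^ (-(6 * κ))) (Set.Ioi 2) :=
    integrableOn_Ioi_rpow_of_lt (by linarith) two_pos
  have hti : Integrable fun u : ℝ =>
      (Set.Ioi (2 : ℝ)).indicator (fun u => u ^ (-(6 * κ))) |u| := by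
    have hi := ht.integrable_indicator measurableSet_Ioi
    refine (hi.add hi.comp_neg).congr (Filter.Eventually.of_forall fun u => ?_)
    simp only [Pi.add_apply, Set.indicator_apply, Set.mem_Ioi]
    rcases le_total 0 u with h | h
    · rw [abs_of_nonneg h, if_neg (show ¬2 < -u by linarith), add_zero]
    · rw [abs_of_nonpos h, if_neg (show ¬2 < u by linarith), zero_add]
  refine ⟨hg.add hti, ?_⟩
  rw [integral_add hg hti, integral_gaussian, integral_comp_abs
    (f := (Set.Ioi (2 : ℝ)).indicator (fun u => u ^ (-(6 * κ)))),
    setIntegral_indicator measurableSet_Ioi]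
  have : Set.Ioi (0 : ℝ) ∩ Set.Ioi 2 = Set.Ioi 2 := by
    ext u
    simp only [Set.mem_inter_iff, Set.mem_Ioi, and_iff_right_iff_imp]
    intro h
    linarith
  rw [this, integral_Ioi_rpow_of_lt (by linarith) two_pos]
  set s := Real.sqrt κ with hs
  have hs2 : s ^ 2 = κ := Real.sq_sqrt hκ0.le
  have hs0 : 1 / 2 ≤ s := by
    rw [hs]
    apply Real.le_sqrt_of_sq_le
    linarith
  have h1 : Real.sqrt (Real.pi / (6 * κ)) ≤ 1 / s := by
    rw [← hs2, Real.sqrt_le_left (by positivity), div_pow, one_pow,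
      div_le_div_iff₀ (by positivity) (by positivity)]
    nlinarith [Real.pi_lt_four, sq_nonneg s]
  have h2 : (2 : ℝ) ^ (-(6 * κ) + 1) ≤ 1 :=
    Real.rpow_le_one_of_one_le_of_nonpos (by norm_num) (by linarith)
  have h3 : -(2 : ℝ) ^ (-(6 * κ) + 1) / (-(6 * κ) + 1) ≤ 1 / s := by
    rw [neg_div, ← div_neg, div_le_div_iff₀ (by linarith) (by linarith)]
    have : (0 : ℝ) < 2 ^ (-(6 * κ) + 1) := by positivity
    nlinarith
  have : 3 / s = 1 / s + 2 * (1 / s) := by ring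
  rw [this]
  gcongr

/-- Restricting to an event and applying Jensen's inequality to `exp`. -/
theorem exp_neg_integral_le_integral_cond {ν : Measure ℝ} [IsProbabilityMeasure ν] {B : Set ℝ}
    {P : ℝ} (hP : 0 < P) (hPB : P ≤ ν.real B) {g : ℝ → ℝ}
    (hg0 : ∀ y, 0 ≤ g y) (hg : Continuous g) {M : ℝ} (hgM : ∀ y, |g y| ≤ M) {κ : ℝ}
    (hκ : 0 ≤ κ) :
    Real.exp (-(κ * ∫ y, g y ∂ν)) ≤ ∫ y, Real.exp (-(κ * P * g y)) ∂(ν[|B]) := by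
  have hB0 : ν B ≠ 0 := by
    intro h
    rw [measureReal_def, h] at hPB
    simp at hPB
    linarith
  have := cond_isProbabilityMeasure (μ := ν) hB0
  have hi : ∀ (m : Measure ℝ) [IsFiniteMeasure m], Integrable g m := fun m _ =>
    Integrable.of_bound hg.aestronglyMeasurable M (Filter.Eventually.of_forall hgM)
  have hq : ∫ y, g y ∂(ν[|B]) = (ν.real B)⁻¹ * ∫ y in B, g y ∂ν := by
    rw [ProbabilityTheory.cond, integral_smul_measure, ENNReal.toReal_inv, smul_eq_mul,
      measureReal_def]
  have hge : 0 ≤ ∫ y, g y ∂(ν[|B]) := integral_nonneg hg0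
  have h1 : P * ∫ y, g y ∂(ν[|B]) ≤ ∫ y, g y ∂ν := by
    calc _ ≤ ν.real B * ∫ y, g y ∂(ν[|B]) := by gcongr
      _ = ∫ y in B, g y ∂ν := by
          rw [hq, mul_inv_cancel_left₀ (by linarith)]
      _ ≤ ∫ y, g y ∂ν :=
          setIntegral_le_integral (hi ν) (Filter.Eventually.of_forall hg0)
  calc Real.exp (-(κ * ∫ y, g y ∂ν))
      ≤ Real.exp (∫ y, -(κ * P * g y) ∂(ν[|B])) := by
        rw [integral_neg, integral_const_mul, Real.exp_le_exp, mul_assoc]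
        have := mul_le_mul_of_nonneg_left h1 hκ
        linarith
    _ ≤ ∫ y, Real.exp (-(κ * P * g y)) ∂(ν[|B]) := by
        apply convexOn_exp.map_integral_le Real.continuous_exp.continuousOn isClosed_univ
        · simp
        · exact ((hi _).const_mul _).neg
        · apply Integrable.of_bound (C := 1)
            (by apply Continuous.aestronglyMeasurable; fun_prop)
          filter_upwards with y
          have := hg0 y
          simp only [Function.comp, Real.norm_eq_abs, Real.abs_exp]
          rw [Real.exp_le_one_iff]
          have : 0 ≤ κ * P * g y := by positivity
          linarith

theorem integral_exp_neg_sum_one_sub_cos_le {ι : Type*} [Fintype ι] {L β κ : ℝ} (hL : 0 < L)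
    (hκ : 1 / 4 ≤ κ) (hβ : 6 * κ ≤ 8 * β * L ^ 2) {x : EuclideanSpace ℝ ι} (hx : ‖x‖ = 1)
    (hx2 : ∀ i, 2 * L * |x i| ≤ 1 / 2) {c τ : ℝ} (hc : c ≠ 0) (hτ : 0 ≤ τ)
    (hcτ : τ * |c| < lcd L x) :
    ∫ t in -τ..τ, Real.exp (-(β * ∑ i, (1 - Real.cos (2 * Real.pi * (t * c * x i)))))
      ≤ L / |c| * (3 / Real.sqrt κ) := by
  obtain ⟨hi, hle⟩ := integral_gaussian_add_tail hκ
  set h : ℝ → ℝ := fun u => Real.exp (-(6 * κ) * u ^ 2)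
        + (Set.Ioi (2 : ℝ)).indicator (fun u => u ^ (-(6 * κ))) |u| with hh
  have h0 : ∀ u, 0 ≤ h u := fun u => by
    apply add_nonneg (Real.exp_pos _).le
    apply Set.indicator_nonneg
    intro v hv
    have : (0 : ℝ) ≤ v := by linarith [Set.mem_Ioi.mp hv]
    positivity
  have hcL : c / L ≠ 0 := div_ne_zero hc hL.ne'
  have hic : Integrable fun t => h (t * (c / L)) := (integrable_comp_mul_right_iff h hcL).mpr hi
  calc _ ≤ ∫ t in -τ..τ, h (t * (c / L)) := by
        apply intervalIntegral.integral_mono_on (by linarith)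
        · apply Continuous.intervalIntegrable
          fun_prop
        · exact hic.intervalIntegrable
        · intro t ht
          have := exp_neg_le_of_lt_lcd (θ := t * c) hL (by linarith) hβ hx hx2 (by
            refine lt_of_le_of_lt ?_ hcτ
            rw [abs_mul]
            gcongr
            exact abs_le.mpr ht)
          simpa [hh, mul_div_assoc] using this
    _ ≤ ∫ t, h (t * (c / L)) := by
        rw [intervalIntegral.integral_of_le (by linarith)]
        exact setIntegral_le_integral hic (Filter.Eventually.of_forall fun t => h0 _)
    _ = L / |c| * ∫ u, h u := by
        rw [Measure.integral_comp_mul_right, smul_eq_mul, inv_div, abs_div, abs_of_pos hL]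
    _ ≤ _ := by gcongr

theorem integral_exp_neg_cosDefect_le {ι : Type*} {ν : Measure ℝ} [IsProbabilityMeasure ν]
    {ε₀ K P L κ r τ : ℝ} (hε₀ : 0 < ε₀) (hL : 0 < L) (hκ : 1 / 4 ≤ κ) (hr : 0 < r)
    (hP : 0 < P) (hPL : 3 / 4 ≤ P * L ^ 2) (hPB : P ≤ ν.real {y | ε₀ < |y| ∧ |y| ≤ K})
    {I : Finset ι} {a : ι → ℝ} {x : EuclideanSpace ℝ I} (hx : ‖x‖ = 1)
    (hax : ∀ i : I, a i = r * x i) (hx2 : ∀ i, 2 * L * |x i| ≤ 1 / 2) (hτ : 0 ≤ τ)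
    (hτK : τ * (K * r) ≤ lcd L x) :
    ∫ t in -τ..τ, Real.exp (-(κ * cosDefect ν I a t))
      ≤ 2 * Real.pi / ε₀ * (L / r * (3 / Real.sqrt κ)) := by
  set B : Set ℝ := {y | ε₀ < |y| ∧ |y| ≤ K} with hBdef
  have hB : MeasurableSet B := by
    apply MeasurableSet.inter
    · exact measurableSet_lt measurable_const continuous_abs.measurable
    · exact measurableSet_le continuous_abs.measurable measurable_const
  have hB0 : ν B ≠ 0 := by
    intro h
    rw [measureReal_def, h] at hPB
    simp at hPB
    linarith
  have := cond_isProbabilityMeasure (μ := ν) hB0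
  have hD := le_lcd hL x
  have hπ := Real.pi_gt_three
  have hcard : ∀ t y, 0 ≤ ∑ k ∈ I, (1 - Real.cos (t * a k * y)) := fun t y =>
    Finset.sum_nonneg fun k _ => by linarith [Real.cos_le_one (t * a k * y)]
  have hκP : 0 ≤ κ * P := by nlinarith
  have hprod : Integrable (Function.uncurry fun t y : ℝ =>
      Real.exp (-(κ * P * ∑ k ∈ I, (1 - Real.cos (t * a k * y)))))
      ((volume.restrict (Set.uIoc (-τ) τ)).prod (ν[|B])) := by
    have : IsFiniteMeasure (volume.restrict (Set.uIoc (-τ) τ)) := by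
      rw [Set.uIoc_of_le (by linarith)]
      infer_instance
    apply Integrable.of_bound (C := 1)
    · apply Continuous.aestronglyMeasurable
      fun_prop
    · filter_upwards with p
      simp only [Function.uncurry, Real.norm_eq_abs, Real.abs_exp, Real.exp_le_one_iff]
      have := mul_nonneg hκP (hcard p.1 p.2)
      linarith
  calc ∫ t in -τ..τ, Real.exp (-(κ * cosDefect ν I a t))
      ≤ ∫ t in -τ..τ, ∫ y, Real.exp (-(κ * P * ∑ k ∈ I, (1 - Real.cos (t * a k * y)))) ∂(ν[|B]) := by
        apply intervalIntegral.integral_mono_on (by linarith)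
        · apply Continuous.intervalIntegrable
          have := continuous_cosDefect ν I a
          fun_prop
        · rw [intervalIntegrable_iff]
          exact hprod.integral_prod_left
        · intro t _
          exact exp_neg_integral_le_integral_cond hP hPB (hcard t) (by fun_prop)
            (fun y => abs_sum_one_sub_cos_le I _) (by linarith)
    _ = ∫ y, (∫ t in -τ..τ,
          Real.exp (-(κ * P * ∑ k ∈ I, (1 - Real.cos (t * a k * y))))) ∂(ν[|B]) :=
        intervalIntegral_integral_swap hprod
    _ ≤ ∫ _y, 2 * Real.pi / ε₀ * (L / r * (3 / Real.sqrt κ)) ∂(ν[|B]) := by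
        apply integral_mono_ae
        · have := hprod.integral_prod_right
          simpa [intervalIntegral.integral_of_le (show -τ ≤ τ by linarith),
            Set.uIoc_of_le (show -τ ≤ τ by linarith), Function.uncurry] using this
        · exact integrable_const _
        · filter_upwards [ae_cond_mem hB] with y hy
          have hy0 : 0 < |y| := hε₀.trans hy.1
          -- With `y` fixed, `θ = t c` is the multiple of the unit vector `x` seen by the cosines.
          set c := r * y / (2 * Real.pi) with hc
          have hcabs : |c| = r * |y| / (2 * Real.pi) := by
            rw [hc, abs_div, abs_mul, abs_of_pos hr, abs_of_pos Real.two_pi_pos]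
          have hsum : ∀ t, ∑ k ∈ I, (1 - Real.cos (t * a k * y))
              = ∑ i, (1 - Real.cos (2 * Real.pi * (t * c * x i))) := by
            intro t
            rw [← Finset.sum_coe_sort]
            refine Finset.sum_congr rfl fun i _ => ?_
            rw [hax, hc]
            congr 2
            field_simp
          simp only [hsum]
          -- The factor `2π` in `c` makes the inequality strict.
          have hlt : τ * |c| < lcd L x := by
            rw [hcabs, mul_div_assoc', div_lt_iff₀ (by positivity)]
            have : τ * (r * |y|) ≤ τ * (K * r) := by
              rw [mul_comm K r]
              gcongr
              exact hy.2
            nlinarith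
          refine (integral_exp_neg_sum_one_sub_cos_le hL hκ (by nlinarith) hx hx2
            (by rw [← abs_pos, hcabs]; positivity) hτ hlt).trans ?_
          have : L / |c| ≤ 2 * Real.pi / ε₀ * (L / r) := by
            rw [hcabs, div_div_eq_mul_div, div_mul_div_comm, div_le_div_iff₀ (by positivity)
              (by positivity)]
            have := hy.1.le
            calc _ = L * (2 * Real.pi) * r * ε₀ := by ring
              _ ≤ L * (2 * Real.pi) * r * |y| := by gcongr
              _ = _ := by ring
          rw [← mul_assoc]
          gcongr
    _ = _ := by simp

/-- Conditioning on one copy bounds the mass near `0` by `1 - p₀`. As `𝔼|Y| ≤ 2M₀`, Markov's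
inequality at `8M₀/p₀` loses a further `p₀/4`. -/
theorem three_quarters_le_symmLaw {ρ : Measure ℝ} [IsProbabilityMeasure ρ] {ε₀ p₀ M₀ : ℝ}
    (hp₀ : 0 < p₀) (hM₀ : 0 < M₀) (hconc : ∀ x, ρ.real {y | |y - x| ≤ ε₀} ≤ 1 - p₀)
    (hint : Integrable (fun y => y) ρ) (hM : ∫ y, |y| ∂ρ ≤ M₀) :
    3 / 4 * p₀ ≤ (symmLaw ρ).real {y | ε₀ < |y| ∧ |y| ≤ 8 * M₀ / p₀} := by
  set K := 8 * M₀ / p₀ with hK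
  have hK0 : 0 < K := by positivity
  set ν := symmLaw ρ with hν
  have hp1 : 0 ≤ 1 - p₀ := measureReal_nonneg.trans (hconc 0)
  have hsmall : ν.real {y | |y| ≤ ε₀} ≤ 1 - p₀ := by
    have hms : MeasurableSet {y : ℝ | |y| ≤ ε₀} :=
      measurableSet_le continuous_abs.measurable measurable_const
    rw [measureReal_def, hν, symmLaw, Measure.map_apply (by fun_prop) hms,
      Measure.prod_apply_symm (hms.preimage (by fun_prop))]
    apply ENNReal.toReal_le_of_le_ofReal hp1
    calc _ ≤ ∫⁻ _y, ENNReal.ofReal (1 - p₀) ∂ρ := by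
          apply lintegral_mono
          intro x
          rw [ENNReal.le_ofReal_iff_toReal_le (measure_ne_top _ _) hp1]
          exact hconc x
      _ = ENNReal.ofReal (1 - p₀) := by simp
  have hlarge : ν.real {y | K ≤ |y|} ≤ p₀ / 4 := by
    have hi1 : Integrable (fun p : ℝ × ℝ => |p.1| + |p.2|) (ρ.prod ρ) :=
      (hint.abs.comp_fst ρ).add (hint.abs.comp_snd ρ)
    have hi2 : Integrable (fun p : ℝ × ℝ => |p.1 - p.2|) (ρ.prod ρ) :=
      ((hint.comp_fst ρ).sub (hint.comp_snd ρ)).abs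
    have hiν : Integrable (fun y => |y|) ν := by
      rw [hν, symmLaw, integrable_map_measure (by fun_prop) (by fun_prop)]
      exact hi2
    have h1 : ∫ y, |y| ∂ν ≤ 2 * M₀ := by
      rw [hν, symmLaw, integral_map (by fun_prop) (by fun_prop)]
      calc ∫ p : ℝ × ℝ, |p.1 - p.2| ∂(ρ.prod ρ) ≤ ∫ p : ℝ × ℝ, (|p.1| + |p.2|) ∂(ρ.prod ρ) :=
            integral_mono hi2 hi1 fun p => abs_sub _ _
        _ = ∫ y, |y| ∂ρ + ∫ y, |y| ∂ρ := by
            rw [integral_add (hint.abs.comp_fst ρ) (hint.abs.comp_snd ρ),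
              integral_fun_fst (fun y => |y|), integral_fun_snd (fun y => |y|)]
            simp
        _ ≤ 2 * M₀ := by linarith
    have h2 := mul_meas_ge_le_integral_of_nonneg
      (Filter.Eventually.of_forall fun y : ℝ => abs_nonneg y) hiν K
    have h3 : K * (p₀ / 4) = 2 * M₀ := by
      rw [hK]
      field_simp
      norm_num
    exact le_of_mul_le_mul_left (h2.trans (h1.trans h3.ge)) hK0
  have hcover : (Set.univ : Set ℝ) ⊆
      ({y | |y| ≤ ε₀} ∪ {y | K ≤ |y|}) ∪ {y | ε₀ < |y| ∧ |y| ≤ K} := by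
    intro y _
    simp only [Set.mem_union, Set.mem_ofPred_eq]
    by_cases h1 : |y| ≤ ε₀
    · exact Or.inl (Or.inl h1)
    · by_cases h2 : K ≤ |y|
      · exact Or.inl (Or.inr h2)
      · exact Or.inr ⟨not_le.mp h1, (not_le.mp h2).le⟩
  have h1 := measureReal_mono (μ := ν) hcover
  have h2 := measureReal_union_le (μ := ν) ({y | |y| ≤ ε₀} ∪ {y | K ≤ |y|})
    {y | ε₀ < |y| ∧ |y| ≤ K}
  have h3 := measureReal_union_le (μ := ν) {y | |y| ≤ ε₀} {y | K ≤ |y|}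
  rw [probReal_univ] at h1
  linarith

/-! ### Combining the blocks. -/

/-- Cover `[0, 1/ε]` by windows of length `τ`. Recentring turns the exponent `m/2` into `m/8`, which
is at least `1/4` precisely when `m ≥ 2`. -/
theorem mul_integral_exp_neg_le {F : ℝ → ℝ} (hF : Continuous F)
    (hsub : ∀ s t, F (t - s) ≤ 2 * F t + 2 * F s) {A τ : ℝ} (hA : 0 ≤ A) (hτ : 0 < τ)
    (hint : ∀ κ, 1 / 4 ≤ κ → ∫ t in -τ..τ, Real.exp (-(κ * F t)) ≤ A / Real.sqrt κ)
    {m : ℕ} (hm : 2 ≤ m) {ε : ℝ} (hε : 0 < ε) :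
    ε * ∫ t in (0 : ℝ)..1 / ε, Real.exp (-((m : ℝ) / 2 * F t))
      ≤ 3 * (A * (ε + 1 / τ)) / Real.sqrt m := by
  have hm2 : (2 : ℝ) ≤ m := by exact_mod_cast hm
  have hsm : 0 < Real.sqrt m := Real.sqrt_pos.mpr (by linarith)
  have h8 : A / Real.sqrt ((m : ℝ) / 2 / 4) ≤ 3 * A / Real.sqrt m := by
    have : Real.sqrt m ≤ 3 * Real.sqrt ((m : ℝ) / 2 / 4) := by
      rw [Real.sqrt_le_left (by positivity), mul_pow, Real.sq_sqrt (by positivity)]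
      linarith
    rw [div_le_div_iff₀ (Real.sqrt_pos.mpr (by linarith)) hsm]
    nlinarith
  have h := integral_le_of_forall_integral_le (g := fun t => Real.exp (-((m : ℝ) / 2 * F t)))
    (by fun_prop) (fun t => (Real.exp_pos _).le) hτ (R := 1 / ε) (by positivity) fun T =>
      ((integral_exp_neg_shift_le hF hsub (by positivity) T hτ.le).trans
        (hint _ (by linarith))).trans h8
  calc _ ≤ ε * ((1 / ε / τ + 1) * (3 * A / Real.sqrt m)) := by gcongr
    _ = _ := by
        field_simp
        ring

/-- For a single block recentring would leave `1/8 < 1/4`. If `ε ≥ 1/τ`, the range already lies in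
the central window and none is needed. -/
theorem mul_integral_exp_neg_half_le {F : ℝ → ℝ} (hF : Continuous F)
    {A τ : ℝ} (hA : 0 ≤ A) (hτ : 0 < τ)
    (hint : ∀ κ, 1 / 4 ≤ κ → ∫ t in -τ..τ, Real.exp (-(κ * F t)) ≤ A / Real.sqrt κ)
    {ε : ℝ} (hε : 1 / τ ≤ ε) :
    ε * ∫ t in (0 : ℝ)..1 / ε, Real.exp (-(1 / 2 * F t)) ≤ 3 * (A * ε) := by
  have hε0 : 0 < ε := lt_of_lt_of_le (by positivity) hε
  have h1 : ∫ t in (0 : ℝ)..1 / ε, Real.exp (-(1 / 2 * F t))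
      ≤ ∫ t in -τ..τ, Real.exp (-(1 / 2 * F t)) := by
    apply intervalIntegral.integral_mono_interval
    · linarith
    · positivity
    · rw [div_le_iff₀ hε0]
      rw [div_le_iff₀ hτ] at hε
      linarith
    · exact Filter.Eventually.of_forall fun t => (Real.exp_pos _).le
    · apply Continuous.intervalIntegrable
      fun_prop
  have h2 : A / Real.sqrt (1 / 2) ≤ 3 * A := by
    have : 1 / 3 ≤ Real.sqrt (1 / 2) := Real.le_sqrt_of_sq_le (by norm_num)
    rw [div_le_iff₀ (by linarith)]
    nlinarith
  calc _ ≤ ε * (3 * A) := by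
        gcongr
        exact (h1.trans (hint _ (by norm_num))).trans h2
    _ = _ := by ring

theorem exp_neg_half_sum_le {κ : Type*} {T : Finset κ} (hT : T.Nonempty) (f : κ → ℝ) :
    Real.exp (-(1 / 2 * ∑ j ∈ T, f j))
      ≤ ∑ j ∈ T, 1 / (T.card : ℝ) * Real.exp (-((T.card : ℝ) / 2 * f j)) := by
  have hT0 : (0 : ℝ) < T.card := by exact_mod_cast hT.card_pos
  have h := convexOn_exp.map_sum_le (t := T) (w := fun _ => 1 / (T.card : ℝ))
    (p := fun j => -((T.card : ℝ) / 2 * f j)) (fun _ _ => by positivity)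
    (by simp [hT0.ne']) (fun _ _ => Set.mem_univ _)
  simp only [smul_eq_mul] at h
  have heq : -(1 / 2 * ∑ j ∈ T, f j)
      = ∑ j ∈ T, 1 / (T.card : ℝ) * -((T.card : ℝ) / 2 * f j) := by
    rw [Finset.mul_sum, ← Finset.sum_neg_distrib]
    refine Finset.sum_congr rfl fun j _ => ?_
    field_simp
  rw [heq]
  exact h

/-- Small ball probability of a sum of independent variables whose coefficients split into blocks,
each of which has small cosine integrals at the origin. -/
theorem measureReal_abs_sum_sub_le {Ω ι κ : Type*} [DecidableEq ι] [MeasurableSpace Ω]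
    {μ : Measure Ω} [IsProbabilityMeasure μ] {ξ : ι → Ω → ℝ} (hm : ∀ k, Measurable (ξ k))
    (hi : iIndepFun ξ μ) {ρ : Measure ℝ} [IsProbabilityMeasure ρ] (hρ : ∀ k, μ.map (ξ k) = ρ)
    (a : ι → ℝ) {T : Finset κ} (hT : T.Nonempty) {B : κ → Finset ι}
    (hB : (T : Set κ).PairwiseDisjoint B) {A τ : κ → ℝ} (hA : ∀ j ∈ T, 0 ≤ A j)
    (hτ : ∀ j ∈ T, 0 < τ j)
    (hint : ∀ j ∈ T, ∀ c, 1 / 4 ≤ c → ∫ t in -(τ j)..τ j,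
      Real.exp (-(c * cosDefect (symmLaw ρ) (B j) a t)) ≤ A j / Real.sqrt c)
    {ε Q : ℝ} (hε : 0 < ε) (hQ : ∀ j ∈ T, A j * (ε + 1 / τ j) ≤ Q) (x : ℝ) :
    μ.real {ω | |∑ k ∈ T.biUnion B, a k * ξ k ω - x| ≤ ε} ≤ 15 * Q / Real.sqrt T.card := by
  set X : Ω → ℝ := fun ω => ∑ k ∈ T.biUnion B, a k * ξ k ω with hX
  have hXm : Measurable X := by
    apply Finset.measurable_fun_sum
    intro k _
    exact (hm k).const_mul _
  have : IsProbabilityMeasure (μ.map X) := Measure.isProbabilityMeasure_map hXm.aemeasurable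
  have hT0 : (0 : ℝ) < T.card := by exact_mod_cast hT.card_pos
  set F : κ → ℝ → ℝ := fun j => cosDefect (symmLaw ρ) (B j) a with hFdef
  have hF : ∀ j, Continuous (F j) := fun j => continuous_cosDefect _ _ _
  have hbound : ∀ δ : ℝ, 0 < δ → μ.real {ω | |X ω - x| ≤ δ} ≤
      ∑ j ∈ T, 1 / (T.card : ℝ) *
        (5 * (δ * ∫ t in (0 : ℝ)..1 / δ, Real.exp (-((T.card : ℝ) / 2 * F j t)))) := by
    intro δ hδ
    have h1 := measureReal_abs_sub_le_le_integral_charFun (μ.map X) x hδ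
    have h2 : (μ.map X).real {y | |y - x| ≤ δ} = μ.real {ω | |X ω - x| ≤ δ} := by
      rw [map_measureReal_apply hXm (measurableSet_le (by fun_prop) measurable_const)]
      rfl
    rw [h2] at h1
    refine h1.trans ?_
    have h3 : ∫ t in (0 : ℝ)..1 / δ, ‖charFun (μ.map X) t‖ ≤
        ∫ t in (0 : ℝ)..1 / δ,
          ∑ j ∈ T, 1 / (T.card : ℝ) * Real.exp (-((T.card : ℝ) / 2 * F j t)) := by
      apply intervalIntegral.integral_mono_on (by positivity)
      · exact continuous_charFun.norm.intervalIntegrable _ _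
      · apply Continuous.intervalIntegrable
        fun_prop
      · intro t _
        refine (norm_charFun_map_sum_le hm hi hρ _ a t).trans ?_
        rw [cosDefect_biUnion _ _ _ _ hB]
        exact exp_neg_half_sum_le hT _
    rw [intervalIntegral.integral_finsetSum fun j _ => by
      apply Continuous.intervalIntegrable
      fun_prop] at h3
    simp only [intervalIntegral.integral_const_mul] at h3
    calc _ ≤ 5 * (δ * ∑ j ∈ T, 1 / (T.card : ℝ) *
          ∫ t in (0 : ℝ)..1 / δ, Real.exp (-((T.card : ℝ) / 2 * F j t))) := by gcongr
      _ = _ := by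
          rw [Finset.mul_sum, Finset.mul_sum]
          refine Finset.sum_congr rfl fun j _ => ?_
          ring
  -- A single block is handled by enlarging the radius to `ε + 1 / τ j`, which `Q` already pays for.
  rcases (show T.card = 1 ∨ 2 ≤ T.card by have := hT.card_pos; omega) with h1 | h2
  · obtain ⟨j, rfl⟩ := Finset.card_eq_one.mp h1
    have hj := Finset.mem_singleton_self j
    have hτj := hτ j hj
    have hδ : 0 < ε + 1 / τ j := by positivity
    have h := hbound _ hδ
    have hmono : μ.real {ω | |X ω - x| ≤ ε} ≤ μ.real {ω | |X ω - x| ≤ ε + 1 / τ j} := by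
      apply measureReal_mono _ (measure_ne_top _ _)
      intro ω (hω : |X ω - x| ≤ ε)
      have : 0 < 1 / τ j := by positivity
      exact hω.trans (by linarith)
    have h3 := mul_integral_exp_neg_half_le (hF j) (hA j hj) hτj (hint j hj)
      (show 1 / τ j ≤ ε + 1 / τ j by linarith)
    have h4 := hQ j hj
    simp only [Finset.sum_singleton, Finset.card_singleton, Nat.cast_one, div_one, one_mul,
      Real.sqrt_one] at h ⊢
    linarith
  · refine (hbound ε hε).trans ?_
    calc _ ≤ ∑ j ∈ T, 1 / (T.card : ℝ) * (15 * Q / Real.sqrt T.card) := by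
          apply Finset.sum_le_sum
          intro j hj
          gcongr
          have h3 := mul_integral_exp_neg_le (hF j) (cosDefect_sub_le _ _ _) (hA j hj) (hτ j hj)
            (hint j hj) h2 hε
          have h4 : 3 * (A j * (ε + 1 / τ j)) / Real.sqrt T.card ≤ 3 * Q / Real.sqrt T.card := by
            gcongr
            exact hQ j hj
          have h5 : 15 * Q / Real.sqrt T.card = 5 * (3 * Q / Real.sqrt T.card) := by ring
          rw [h5]
          linarith
      _ = _ := by
          rw [Finset.sum_const, nsmul_eq_mul]
          field_simp

/-! ### The median and the spread blocks. -/

theorem upperMedian_mem {s : Multiset ℝ} (hs : 0 < s.card) : upperMedian s ∈ s := by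
  have hlen : s.card / 2 < (s.sort (· ≤ ·)).length := by
    rw [Multiset.length_sort]
    omega
  unfold upperMedian
  rw [List.getD_eq_getElem _ _ hlen, ← Multiset.mem_sort (· ≤ ·)]
  exact List.getElem_mem hlen

theorem measureReal_le_levyConc {Ω : Type*} [MeasurableSpace Ω] (μ : Measure Ω)
    [IsProbabilityMeasure μ] (X : Ω → ℝ) (ε x : ℝ) :
    μ.real {ω | |X ω - x| ≤ ε} ≤ levyConc μ X ε :=
  le_ciSup (f := fun x : ℝ => μ.real {ω | |X ω - x| ≤ ε})
    ⟨1, by rintro _ ⟨y, rfl⟩; exact measureReal_le_one⟩ x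

namespace SpreadData

variable {n : ℕ} {c₀ c₁ cs lam : ℝ} {v : EuclideanSpace ℝ (Fin n)}
  (S : SpreadData n c₀ c₁ cs lam v)

theorem block_subset_spread (j : Fin (⌈cs * n⌉₊ / ⌈lam * n⌉₊)) : S.block j ⊆ S.spread := by
  refine subset_trans ?_ S.spreadLam_subset
  rw [← S.union_block]
  exact Finset.subset_biUnion_of_mem S.block (Finset.mem_univ j)

/-- The median is the LCD of some block, hence at least `L`; `j` only witnesses that there are
blocks. -/
theorem mrlcd_pos {L : ℝ} (hL : 0 < L) (j : Fin (⌈cs * n⌉₊ / ⌈lam * n⌉₊)) : 0 < S.mrlcd L := by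
  have hcard : 0 < ((Finset.univ : Finset (Fin (⌈cs * n⌉₊ / ⌈lam * n⌉₊))).val.map
      (fun j => blockLcd L v (S.block j))).card := by
    rw [Multiset.card_map]
    exact Finset.card_pos.mpr ⟨j, Finset.mem_univ j⟩
  obtain ⟨i, -, hi⟩ := Multiset.mem_map.mp (upperMedian_mem hcard)
  change blockLcd L v (S.block i) = S.mrlcd L at hi
  rw [← hi]
  exact hL.trans_le (le_lcd hL _)

theorem le_norm_restrictCoords (hc₁ : 0 < c₁) (j : Fin (⌈cs * n⌉₊ / ⌈lam * n⌉₊)) :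
    c₁ * Real.sqrt (⌈lam * n⌉₊ / (2 * n)) ≤ ‖restrictCoords v (S.block j)‖ := by
  rw [EuclideanSpace.norm_eq]
  apply Real.le_sqrt_of_sq_le
  rw [mul_pow, Real.sq_sqrt (by positivity)]
  calc c₁ ^ 2 * (⌈lam * n⌉₊ / (2 * n)) = ∑ _i : S.block j, (c₁ / Real.sqrt (2 * n)) ^ 2 := by
        rw [Finset.sum_const, Finset.card_univ, Fintype.card_coe, S.card_block, nsmul_eq_mul,
          div_pow, Real.sq_sqrt (by positivity)]
        ring
    _ ≤ _ := by
        apply Finset.sum_le_sum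
        intro i _
        rw [Real.norm_eq_abs]
        gcongr
        exact S.lower_bound i (S.block_subset_spread j i.2)

/-- The normalized coordinates of a block are small once the blocks are long. -/
theorem two_mul_abs_normalized_le {L : ℝ} (hL : 0 < L) (hc₀ : 0 < c₀) (hc₁ : 0 < c₁) (hn : 0 < n)
    (hlam : 32 / (c₀ * c₁ ^ 2) * L ^ 2 ≤ ⌈lam * n⌉₊) (j : Fin (⌈cs * n⌉₊ / ⌈lam * n⌉₊))
    (i : S.block j) :
    2 * L * |(‖restrictCoords v (S.block j)‖⁻¹ • restrictCoords v (S.block j)) i| ≤ 1 / 2 := by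
  have hn' : (0 : ℝ) < n := by exact_mod_cast hn
  set ℓ : ℝ := (⌈lam * n⌉₊ : ℝ) with hℓ
  have hℓ0 : 0 < ℓ := lt_of_lt_of_le (by positivity) hlam
  set r := ‖restrictCoords v (S.block j)‖ with hr
  have hrle : c₁ * Real.sqrt (ℓ / (2 * n)) ≤ r := S.le_norm_restrictCoords hc₁ j
  have hr0 : 0 < r := lt_of_lt_of_le (by positivity) hrle
  have hv : |v i| ≤ 1 / Real.sqrt (c₀ * n) := S.upper_bound i (S.block_subset_spread j i.2)
  have hval : (r⁻¹ • restrictCoords v (S.block j)) i = r⁻¹ * v i := rfl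
  rw [hval, abs_mul, abs_of_pos (inv_pos.mpr hr0)]
  -- Squared, this reads `32 L² ≤ c₀ c₁² ℓ`, the origin of the constant `32 / (c₀ c₁²)`.
  have hkey : 4 * L * (1 / Real.sqrt (c₀ * n)) ≤ c₁ * Real.sqrt (ℓ / (2 * n)) := by
    apply le_of_sq_le_sq _ (by positivity)
    rw [mul_pow, mul_pow, div_pow, mul_pow c₁, Real.sq_sqrt (by positivity),
      Real.sq_sqrt (by positivity)]
    rw [div_mul_eq_mul_div, div_le_iff₀ (by positivity)] at hlam
    rw [one_pow, mul_one_div, mul_div_assoc', div_le_div_iff₀ (by positivity) (by positivity)]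
    nlinarith
  have h1 : 4 * L * |v i| ≤ r :=
    (mul_le_mul_of_nonneg_left hv (by positivity)).trans (hkey.trans hrle)
  have h2 : 2 * L * (r⁻¹ * |v i|) = 4 * L * |v i| / r / 2 := by
    ring
  rw [h2]
  have : 4 * L * |v i| / r ≤ 1 := (div_le_one hr0).mpr h1
  linarith

theorem pairwiseDisjoint_of_forall_eq_block {T : Finset (Finset (Fin n))}
    (hT : ∀ I ∈ T, ∃ j, I = S.block j) : (T : Set (Finset (Fin n))).PairwiseDisjoint id := by
  intro I hI I' hI' hne
  obtain ⟨j, rfl⟩ := hT I hI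
  obtain ⟨j', rfl⟩ := hT I' hI'
  exact S.disjoint_block j j' fun h => hne (by rw [h])

theorem card_biUnion_of_forall_eq_block {T : Finset (Finset (Fin n))}
    (hT : ∀ I ∈ T, ∃ j, I = S.block j) : (T.biUnion id).card = T.card * ⌈lam * n⌉₊ := by
  rw [Finset.card_biUnion (S.pairwiseDisjoint_of_forall_eq_block hT)]
  refine Finset.sum_const_nat fun I hI => ?_
  obtain ⟨j, rfl⟩ := hT I hI
  exact S.card_block j

end SpreadData

/-! ### Rescaling from blocks to `J`, and conclusion. -/

theorem div_add_one_div_div_sqrt_le {c₁ ε D l ℓ m n : ℝ} (hc₁ : 0 < c₁) (hε : 0 ≤ ε) (hD : 0 < D)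
    (hl : 0 < l) (hℓ : 0 < ℓ) (hm : 0 < m) (hn : 0 < n) (hle : ℓ ≤ 2 * l) :
    (ε / (c₁ * Real.sqrt (ℓ / (2 * n))) + 1 / D) / Real.sqrt m
      ≤ 2 * (ε / (c₁ * Real.sqrt (m * ℓ / n)) + Real.sqrt (l / (m * ℓ)) / D) := by
  have hsm : 0 < Real.sqrt m := Real.sqrt_pos.mpr hm
  have h1 : Real.sqrt (m * ℓ / n) ≤ 2 * (Real.sqrt (ℓ / (2 * n)) * Real.sqrt m) := by
    rw [← Real.sqrt_mul (by positivity), Real.sqrt_le_left (by positivity), mul_pow,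
      Real.sq_sqrt (by positivity)]
    have : ℓ / (2 * n) * m = m * ℓ / n / 2 := by field_simp
    rw [this]
    have : 0 < m * ℓ / n := by positivity
    linarith
  have h2 : 1 / Real.sqrt m ≤ 2 * Real.sqrt (l / (m * ℓ)) := by
    rw [div_le_iff₀ hsm, mul_assoc, ← Real.sqrt_mul (by positivity)]
    have : l / (m * ℓ) * m = l / ℓ := by field_simp
    rw [this]
    have : 1 / 2 ≤ Real.sqrt (l / ℓ) := by
      apply Real.le_sqrt_of_sq_le
      rw [le_div_iff₀ hℓ]
      linarith
    linarith
  have h3 : ε / (c₁ * Real.sqrt (ℓ / (2 * n))) / Real.sqrt m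
      ≤ 2 * (ε / (c₁ * Real.sqrt (m * ℓ / n))) := by
    rw [div_div, mul_div_assoc', div_le_div_iff₀ (by positivity) (by positivity)]
    have := mul_le_mul_of_nonneg_left h1 (mul_nonneg hε hc₁.le)
    linarith
  have h4 : 1 / D / Real.sqrt m ≤ 2 * (Real.sqrt (l / (m * ℓ)) / D) := by
    have h := div_le_div_of_nonneg_right h2 hD.le
    calc _ = 1 / Real.sqrt m / D := by ring
      _ ≤ _ := h
      _ = _ := by ring
  rw [add_div]
  linarith

theorem mainTheorem7 (ε₀ p₀ M₀ : ℝ) (hε₀ : 0 < ε₀) (hp₀ : 0 < p₀) (hM₀ : 0 < M₀) :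
    ∃ C : ℝ, 0 < C ∧
      ∀ c₀ c₁ : ℝ, c₀ ∈ Set.Ioo (0 : ℝ) 1 → c₁ ∈ Set.Ioo (0 : ℝ) 1 →
        ∃ C' : ℝ, 0 < C' ∧ ∃ N₀ : ℕ, ∀ n : ℕ, N₀ ≤ n →
          ∀ (Ω : Type*) [MeasurableSpace Ω] (μ : Measure Ω) [IsProbabilityMeasure μ]
            (ξ : Fin n → Ω → ℝ),
            (∀ k, Measurable (ξ k)) → iIndepFun ξ μ →
            (∀ i j, IdentDistrib (ξ i) (ξ j) μ μ) →
            (∀ k, levyConc μ (ξ k) ε₀ ≤ 1 - p₀) →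
            (∀ k, Integrable (ξ k) μ ∧ ∫ ω, |ξ k ω| ∂μ ≤ M₀) →
          ∀ cs ∈ Set.Ioo (0 : ℝ) (1 / 5), ∀ L : ℝ, 1 / Real.sqrt p₀ ≤ L →
          ∀ lam ∈ Set.Ioo (C' * L ^ 2 / n) cs,
          ∀ v ∈ incompVectors n c₀ c₁, ∀ S : SpreadData n c₀ c₁ cs lam v,
          ∀ J : Finset (Fin n), J.Nonempty →
            (∃ T : Finset (Finset (Fin n)), (∀ I ∈ T, I ∈ S.medianBlocks L) ∧ J = T.biUnion id) →
          ∀ ε : ℝ, 0 ≤ ε →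
            levyConc μ (fun ω => ∑ k ∈ J, v k * ξ k ω) ε ≤
              C * L * (ε / (c₁ * Real.sqrt ((J.card : ℝ) / n)) +
                Real.sqrt (lam * n / J.card) / S.mrlcd L) := by
  set K := 8 * M₀ / p₀ with hKdef
  have hK : 0 < K := by positivity
  set C₁ := 2 * Real.pi / ε₀ * 3 * (1 + K) with hC₁
  have hC₁0 : 0 < C₁ := by positivity
  refine ⟨30 * C₁, by positivity, fun c₀ c₁ hc₀ hc₁ => ?_⟩
  have hc₀0 := hc₀.1
  have hc₁0 := hc₁.1
  refine ⟨32 / (c₀ * c₁ ^ 2), by positivity, 1, ?_⟩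
  intro n hn Ω _ μ _ ξ hmeas hindep hident hconc hmom cs _ L hL lam hlam v _ S J hJ hT ε hε
  obtain ⟨T, hTmed, rfl⟩ := hT
  have hblock : ∀ I ∈ T, ∃ j, I = S.block j := fun I hI => (hTmed I hI).1
  have hTne : T.Nonempty := by
    obtain ⟨k, hk⟩ := hJ
    obtain ⟨I, hI, -⟩ := Finset.mem_biUnion.mp hk
    exact ⟨I, hI⟩
  have hn0 : (0 : ℝ) < n := by exact_mod_cast hn
  have hL0 : 0 < L := lt_of_lt_of_le (by positivity) hL
  have hpL : 1 ≤ p₀ * L ^ 2 := by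
    have h1 : 1 ≤ L * Real.sqrt p₀ := (div_le_iff₀ (Real.sqrt_pos.mpr hp₀)).mp hL
    have h2 : 1 ≤ (L * Real.sqrt p₀) ^ 2 := one_le_pow₀ h1
    rwa [mul_pow, Real.sq_sqrt hp₀.le, mul_comm] at h2
  -- the common law of the variables
  set k₀ : Fin n := ⟨0, hn⟩
  set ρ := μ.map (ξ k₀) with hρdef
  have hρ : ∀ k, μ.map (ξ k) = ρ := fun k => (hident k k₀).map_eq
  have : IsProbabilityMeasure ρ := Measure.isProbabilityMeasure_map (hmeas k₀).aemeasurable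
  have hρconc : ∀ x, ρ.real {y | |y - x| ≤ ε₀} ≤ 1 - p₀ := by
    intro x
    rw [hρdef, map_measureReal_apply (hmeas k₀) (measurableSet_le (by fun_prop) measurable_const)]
    exact (measureReal_le_levyConc μ (ξ k₀) ε₀ x).trans (hconc k₀)
  have hP := three_quarters_le_symmLaw hp₀ hM₀ hρconc
    ((integrable_map_measure (by fun_prop) (hmeas k₀).aemeasurable).mpr (hmom k₀).1)
    (by
      rw [hρdef, integral_map (hmeas k₀).aemeasurable (by fun_prop)]
      exact (hmom k₀).2)
  have hp1 : p₀ ≤ 1 := by linarith [measureReal_nonneg.trans (hρconc 0)]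
  -- block length
  have hlamn : 32 / (c₀ * c₁ ^ 2) * L ^ 2 < lam * n := (div_lt_iff₀ hn0).mp hlam.1
  have hlamn1 : 1 ≤ lam * n := by
    have h1 : 1 ≤ L ^ 2 := by nlinarith [sq_nonneg L]
    have h2 : 1 ≤ 32 / (c₀ * c₁ ^ 2) := by
      rw [le_div_iff₀ (by positivity)]
      have := hc₀.2
      have := hc₁.2
      nlinarith [mul_le_one₀ hc₀.2.le (sq_nonneg c₁) (pow_le_one₀ hc₁0.le hc₁.2.le)]
    nlinarith
  set ℓ : ℝ := (⌈lam * n⌉₊ : ℝ) with hℓdef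
  have hℓge : lam * n ≤ ℓ := Nat.le_ceil _
  have hℓle : ℓ ≤ 2 * (lam * n) := by
    have := Nat.ceil_lt_add_one (show 0 ≤ lam * n by linarith)
    linarith
  have hℓ0 : 0 < ℓ := by linarith
  -- lower bound for the block norms and for the median
  set D := S.mrlcd L with hD
  have hD0 : 0 < D := by
    obtain ⟨I, hI⟩ := hTne
    obtain ⟨j, -⟩ := hblock I hI
    exact S.mrlcd_pos hL0 j
  set r := c₁ * Real.sqrt (ℓ / (2 * n)) with hr
  have hr0 : 0 < r := by positivity
  have hnorm : ∀ I ∈ T, r ≤ ‖restrictCoords v I‖ := by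
    intro I hI
    obtain ⟨j, rfl⟩ := hblock I hI
    exact S.le_norm_restrictCoords hc₁0 j
  have hm0 : (0 : ℝ) < T.card := by exact_mod_cast hTne.card_pos
  have hcard : ((T.biUnion id).card : ℝ) = T.card * ℓ := by
    rw [S.card_biUnion_of_forall_eq_block hblock]
    push_cast
    rfl
  apply ciSup_le
  intro x
  -- Esseen's inequality needs a positive radius. Widening by `r / D` covers `ε = 0` and costs only
  -- a term `1 / D`.
  have hmono : μ.real {ω | |∑ k ∈ T.biUnion id, v k * ξ k ω - x| ≤ ε}
      ≤ μ.real {ω | |∑ k ∈ T.biUnion id, v k * ξ k ω - x| ≤ ε + r / D} := by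
    apply measureReal_mono _ (measure_ne_top _ _)
    intro ω (hω : _ ≤ ε)
    have : 0 < r / D := by positivity
    exact hω.trans (by linarith)
  refine hmono.trans ?_
  have hmain := measureReal_abs_sum_sub_le hmeas hindep hρ v hTne
    (S.pairwiseDisjoint_of_forall_eq_block hblock)
    (A := fun I => 2 * Real.pi / ε₀ * (L / ‖restrictCoords v I‖ * 3))
    -- This is the window allowed by the median for `|Y| ≤ K`. The block norm cancels in `A I / τ
    -- I`, so only a lower bound on it is needed.
    (τ := fun I => D / (K * ‖restrictCoords v I‖))
    (fun I _ => by positivity)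
    (fun I hI => by
      have := hr0.trans_le (hnorm I hI)
      positivity)
    (fun I hI c hc => by
      have hRI := hr0.trans_le (hnorm I hI)
      have hmed : D ≤ blockLcd L v I := (hTmed I hI).2
      obtain ⟨j, rfl⟩ := hblock I hI
      refine (integral_exp_neg_cosDefect_le (x := ‖restrictCoords v (S.block j)‖⁻¹ •
          restrictCoords v (S.block j)) hε₀ hL0 hc hRI (by positivity) (by linarith) hP
        (by rw [norm_smul, norm_inv, norm_norm, inv_mul_cancel₀ hRI.ne']) ?_
        (S.two_mul_abs_normalized_le hL0 hc₀0 hc₁0 hn (by linarith) j)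
        (by positivity) ?_).trans_eq (by ring)
      · intro i
        change v i = _ * (_ * v i)
        rw [mul_inv_cancel_left₀ hRI.ne']
      · rw [div_mul_cancel₀ _ (by positivity)]
        exact hmed)
    (ε := ε + r / D) (Q := C₁ * L * (ε / r + 1 / D)) (by positivity)
    (fun I hI => by
      have hRI := hr0.trans_le (hnorm I hI)
      have h1 : (ε + r / D) / ‖restrictCoords v I‖ ≤ ε / r + 1 / D := by
        calc _ ≤ (ε + r / D) / r := by
              gcongr
              exact hnorm I hI
          _ = _ := by field_simp
      have h2 : (ε + r / D) / ‖restrictCoords v I‖ + K / D ≤ (1 + K) * (ε / r + 1 / D) := by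
        have : 0 ≤ K * (ε / r) := by positivity
        have h3 : K / D = K * (1 / D) := by ring
        rw [h3]
        linarith
      calc _ = 2 * Real.pi / ε₀ * 3 * L * ((ε + r / D) / ‖restrictCoords v I‖ + K / D) := by
            field_simp
        _ ≤ 2 * Real.pi / ε₀ * 3 * L * ((1 + K) * (ε / r + 1 / D)) := by gcongr
        _ = _ := by
            rw [hC₁]
            ring) x
  refine hmain.trans ?_
  have hfin := div_add_one_div_div_sqrt_le hc₁0 hε hD0 (show 0 < lam * n by linarith) hℓ0 hm0 hn0
    hℓle
  rw [hcard]
  calc _ = 15 * C₁ * L * ((ε / r + 1 / D) / Real.sqrt T.card) := by ring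
    _ ≤ 15 * C₁ * L * _ := mul_le_mul_of_nonneg_left hfin (by positivity)
    _ = _ := by ring
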